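/- Let $\mathcal H$ be a finite-dimensional complex Hilbert space. An ensemble on $\mathcal H$ is a finite family $\{p_i,\rho_i\}_i$ of density operators $\rho_i$ with probabilities $p_i>0$, $\sum_i p_i=1$. An optimal POVM for it is a POVM $\{\Pi_i\}_i$ ($\Pi_i\ge 0$, $\sum_i\Pi_i=\mathbb 1$) that maximizes the success probability $\sum_i p_i\operatorname{Tr}(\rho_i\Pi_i)$ over all POVMs with the same index set. The ensemble is linearly independent (LI) with ranks $r_1,\dots,r_m$ if $\operatorname{rank}\rho_i=r_i$ and the supports of $\rho_1,\dots,\rho_m$ are linearly independent subspaces that together span $\mathcal H$. The pretty good measurement $\mathrm{PGM}(\widetilde Q)$ of $\widetilde Q=\{q_i,\sigma_i\}_i$ has the elements $\left(\sum_j q_j\sigma_j\right)^{-1/2}q_i\sigma_i\left(\sum_j q_j\sigma_j\right)^{-1/2}$. For an LI ensemble $\widetilde P=\{p_i,\rho_i\}_{i=1}^m$ with ranks $r_i$, define $\mathscr R(\widetilde P)=\{q_i,\sigma_i\}_{i=1}^m$ as follows. Let $\{\Pi_i\}$ be an optimal POVM for $\widetilde P$. Write $p_i\rho_i=\sum_{j=1}^{r_i}|\tilde\psi_{ij}\rangle\langle\tilde\psi_{ij}|$,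 let $G$ be the Gram matrix of the vectors $\tilde\psi_{ij}$, and let $\tilde u_{ij}$ be the dual family, $\langle\tilde\psi_{ij}|\tilde u_{lk}\rangle=\delta_{il}\delta_{jk}$. Write $\Pi_i=\sum_{j=1}^{r_i}|w_{ij}\rangle\langle w_{ij}|$ with $\{w_{ij}\}$ orthonormal, and $w_{ij}=\sum_{l,k}(G^{1/2}W)_{lk,ij}\,\tilde u_{lk}$ with $W$ unitary, where the $w_{ij}$ are chosen such that the diagonal blocks $X^{(ii)}$ (of size $r_i\times r_i$) of $G^{1/2}W$ are positive semidefinite. Put $\tilde\chi_{ij}=\sum_k X^{(ii)}_{kj}\tilde\psi_{ik}$, and let $$\sigma_i=\frac{\sum_j|\tilde\chi_{ij}\rangle\langle\tilde\chi_{ij}|}{\sum_j\|\tilde\chi_{ij}\|^2},\qquad q_i=\frac{\sum_j\|\tilde\chi_{ij}\|^2}{\sum_{l,k}\|\tilde\chi_{lk}\|^2}.$$ Claim. For every LI ensemble $\widetilde P=\{p_i,\rho_i\}_{i=1}^m$ with ranks $r_1,\dots,r_m$: (a) $\widetilde P$ has a unique optimal POVM $\{\Pi_i\}_{i=1}^m$;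 the ensemble $\mathscr R(\widetilde P)=\{q_i,\sigma_i\}$ exists and does not depend on the choices made; it is LI with the same ranks; and $\mathrm{PGM}(\mathscr R(\widetilde P))=\{\Pi_i\}$. (b) There are linearly independent unit vectors $\psi_{ij}$, an orthonormal family $w'_{ij}$, and probabilities $\lambda_{ij}>0$ and $\lambda'_{ij}>0$ ($1\le i\le m$, $1\le j\le r_i$), each summing to one, such that - $p_i\rho_i=\sum_{j}\lambda_{ij}|\psi_{ij}\rangle\langle\psi_{ij}|$ for all $i$, and $A=\{\lambda_{ij},|\psi_{ij}\rangle\langle\psi_{ij}|\}$ is an LI ensemble of pure states; - the unique optimal POVM of $A$ is $\{|w'_{ij}\rangle\langle w'_{ij}|\}$, and it refines the optimal POVM of $\widetilde P$: $\Pi_i=\sum_{j}|w'_{ij}\rangle\langle w'_{ij}|$ for all $i$; - $\mathscr R(A)=\{\lambda'_{ij},|\psi_{ij}\rangle\langle\psi_{ij}|\}$ (the map $\mathscr R$ for the $\sum_i r_i$ pure states, all of rank $1$), its PGM is $\{|w'_{ij}\rangle\langle w'_{ij}|\}$, and it is a pure-state decomposition of $\mathscr R(\widetilde P)$: $q_i\sigma_i=\sum_{j}\lambda'_{ij}|\psi_{ij}\rangle\langle\psi_{ij}|$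 for all $i$. -/

import Mathlib

open scoped ComplexOrder MatrixOrder

namespace MED

noncomputable section

/-- An ensemble of quantum states on `H`: strictly positive probabilities `p i` summing to one,
and density operators `ρ i` (positive operators of trace one). -/
@[ext]
structure Ensemble (H : Type*) [NormedAddCommGroup H] [InnerProductSpace ℂ H] [CompleteSpace H]
    (ι : Type*) [Fintype ι] where
  prob : ι → ℝ
  state : ι → H →L[ℂ] H
  prob_pos : ∀ i, 0 < prob i
  prob_sum : ∑ i, prob i = 1
  state_pos : ∀ i, (state i).IsPositive
  state_trace : ∀ i, LinearMap.trace ℂ H (state i : H →ₗ[ℂ] H) = 1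

/-- A positive operator valued measure with outcomes in the finite type `ι`. -/
@[ext]
structure POVM (H : Type*) [NormedAddCommGroup H] [InnerProductSpace ℂ H] [CompleteSpace H]
    (ι : Type*) [Fintype ι] where
  elem : ι → H →L[ℂ] H
  elem_pos : ∀ i, (elem i).IsPositive
  elem_sum : ∑ i, elem i = 1

variable {H : Type*} [NormedAddCommGroup H] [InnerProductSpace ℂ H] [CompleteSpace H]
  {ι : Type*} [Fintype ι]

/-- The rank-one operator `|v⟩⟨v|`. -/
abbrev ketbra (v : H) : H →L[ℂ] H := InnerProductSpace.rankOne ℂ v v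

/-- The unnormalized state `p i • ρ i`. -/
def Ensemble.weighted (P : Ensemble H ι) (i : ι) : H →L[ℂ] H := (P.prob i : ℂ) • P.state i

/-- `P` is a linearly independent ensemble whose `i`-th state has rank `r i`: the supports of the
states (for a positive operator the support is the range) are linearly independent subspaces
which together span `H`, and the `i`-th one has dimension `r i`. -/
structure Ensemble.IsLI (P : Ensemble H ι) (r : ι → ℕ) : Prop where
  indep : iSupIndep fun i => (P.state i : H →ₗ[ℂ] H).range
  span : ⨆ i, (P.state i : H →ₗ[ℂ] H).range = ⊤
  rank : ∀ i, Module.finrank ℂ (P.state i : H →ₗ[ℂ] H).range = r i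

/-- The average probability of success `∑ i, p i * Tr (ρ i * E i)` of the measurement `E`. -/
def successProb (P : Ensemble H ι) (E : POVM H ι) : ℝ :=
  ∑ i, P.prob i * (LinearMap.trace ℂ H (P.state i * E.elem i : H →L[ℂ] H)).re

/-- `E` is an optimal POVM for the minimum error discrimination of `P`: it attains the maximum of
the success probability over all POVMs with the same outcomes. -/
def IsOptimal (P : Ensemble H ι) (E : POVM H ι) : Prop :=
  ∀ E' : POVM H ι, successProb P E' ≤ successProb P E

/-- The operator `(∑ j, q j • σ j) ^ (-1/2) * (q i • σ i) * (∑ j, q j • σ j) ^ (-1/2)`, that is, the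
`i`-th element of the pretty good measurement of `Q`. -/
def pgm (Q : Ensemble H ι) (i : ι) : H →L[ℂ] H :=
  (∑ j, Q.weighted j) ^ (-(1 / 2) : ℝ) * Q.weighted i * (∑ j, Q.weighted j) ^ (-(1 / 2) : ℝ)

/-- The family `u` dual to a linearly independent family `ψ`: `u a = ∑ b, (G⁻¹) b a • ψ b`, where
`G` is the Gram matrix of `ψ`. -/
def dualFamily {κ : Type*} [Fintype κ] [DecidableEq κ] (ψ : κ → H) (a : κ) : H :=
  ∑ b, (Matrix.gram ℂ ψ)⁻¹ b a • ψ b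

/-- The relation `Q = ℛ(P)`, for an ensemble `P` with ranks `r`. Choose

* a decomposition `p i • ρ i = ∑ j, |ψ i j⟩⟨ψ i j|` into `r i` unnormalized pure states,
* a spectral decomposition `E i = ∑ j, |w i j⟩⟨w i j|` of an optimal POVM `E` for `P`, with `w`
  orthonormal,

and let `W` be the unitary matrix such that `w` has the coefficient matrix `X = G ^ (1/2) * W` in
the family dual to `ψ`, where `G` is the Gram matrix of `ψ`; the choices have to be such
that the diagonal blocks `X i i` (of size `r i`) are positive semidefinite. Put
`χ i j = ∑ k, (X i i) k j • ψ i k`. Then `Q` has the states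
`σ i = (∑ j, ‖χ i j‖ ^ 2)⁻¹ • ∑ j, |χ i j⟩⟨χ i j|`, with the probabilities
`q i = (∑ j, ‖χ i j‖ ^ 2) / ∑ l, ∑ k, ‖χ l k‖ ^ 2`. -/
def IsRImage [DecidableEq ι] (r : ι → ℕ) (P Q : Ensemble H ι) : Prop :=
  ∃ (E : POVM H ι) (ψ w χ : (i : ι) × Fin (r i) → H)
    (W X : Matrix ((i : ι) × Fin (r i)) ((i : ι) × Fin (r i)) ℂ),
    IsOptimal P E ∧
    (∀ i, P.weighted i = ∑ j, ketbra (ψ ⟨i, j⟩)) ∧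
    Orthonormal ℂ w ∧
    (∀ i, E.elem i = ∑ j, ketbra (w ⟨i, j⟩)) ∧
    W ∈ Matrix.unitaryGroup ((i : ι) × Fin (r i)) ℂ ∧
    X = CFC.sqrt (Matrix.gram ℂ ψ) * W ∧
    (∀ a, w a = ∑ b, X b a • dualFamily ψ b) ∧
    (∀ i, (X.blockDiag' i).PosSemidef) ∧
    (∀ i j, χ ⟨i, j⟩ = ∑ k, X.blockDiag' i k j • ψ ⟨i, k⟩) ∧
    (∀ i, Q.prob i = (∑ j, ‖χ ⟨i, j⟩‖ ^ 2) / ∑ l, ∑ k, ‖χ ⟨l, k⟩‖ ^ 2) ∧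
    (∀ i, Q.state i = (((∑ j, ‖χ ⟨i, j⟩‖ ^ 2)⁻¹ : ℝ) : ℂ) • ∑ j, ketbra (χ ⟨i, j⟩))

/-- The pure ensemble `A`, indexed by the pairs `(i, j)` with `j < r i`, with the states
`|ψ i j⟩⟨ψ i j|` for unit vectors `ψ i j`, is a pure state decomposition of `P`:
`p i • ρ i = ∑ j, λ i j • |ψ i j⟩⟨ψ i j|` for all `i`, where `λ` are the probabilities of `A`. -/
structure IsPureDecomposition {r : ι → ℕ} (P : Ensemble H ι)
    (A : Ensemble H ((i : ι) × Fin (r i))) (ψ : (i : ι) × Fin (r i) → H) : Prop where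
  norm_eq_one : ∀ a, ‖ψ a‖ = 1
  state_eq : ∀ a, A.state a = ketbra (ψ a)
  weighted_eq : ∀ i, P.weighted i = ∑ j, A.weighted ⟨i, j⟩

end

end MED

open MED

/-! Write R_i for the weighted state p_i ρ_i. Minimum error discrimination is a semidefinite
program: an optimal measurement E comes with a dual operator Z such that Z ≥ R_i and Z E_i = R_i E_i
(`IsOptimal.exists_isDualCert`), and this Z certifies all optimal measurements at once. Linear
independence makes Z invertible and, since Z E_i takes its values in the support of R_i, forces E_i
E'_j = 0 for i ≠ j and any two optimal E, E'. Hence E is unique and projective, and E_i has rank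
r_i.

Everything else is read off from Z. Diagonalizing the compression of Z to the range of each E_i
gives an orthonormal basis w_ij with eigenvalues a_ij > 0 and R_i = ∑_j a_ij⁻¹ |Z w_ij⟩⟨Z w_ij|
(`Ensemble.IsLI.exists_isFrame`). Whatever the choices in the definition of ℛ, χ_ij is the image
under Z of the chosen eigenvector, so q_i σ_i is Z E_i Z up to a common constant; these operators
sum to Z², and the pretty good measurement returns E_i (`IsFrame.exists_rImage`). The terms of the
decomposition of R_i form the pure ensemble A. The same Z certifies {|w_ij⟩⟨w_ij|} for A
(`IsFrame.pure`), so the same computation gives ℛ(A), along the same vectors Z w_ij. -/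

namespace MED

open scoped InnerProductSpace

set_option linter.unusedSectionVars false

section

variable {H : Type*} [NormedAddCommGroup H] [InnerProductSpace ℂ H] [CompleteSpace H]
  {ι : Type*} [Fintype ι]

/-! ### The trace of a product of operators -/

/-- The trace as a linear functional on the continuous operators. -/
noncomputable def opTrace : (H →L[ℂ] H) →ₗ[ℂ] ℂ :=
  LinearMap.trace ℂ H ∘ₗ ContinuousLinearMap.coeLM ℂ

theorem opTrace_apply (T : H →L[ℂ] H) : opTrace T = LinearMap.trace ℂ H (T : H →ₗ[ℂ] H) := rfl

theorem opTrace_mul_comm (S T : H →L[ℂ] H) : opTrace (S * T) = opTrace (T * S) :=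
  LinearMap.trace_mul_comm ℂ (S : H →ₗ[ℂ] H) (T : H →ₗ[ℂ] H)

theorem mul_ketbra (T : H →L[ℂ] H) (v : H) :
    T * ketbra v = InnerProductSpace.rankOne ℂ (T v) v := by
  ext x; simp

theorem ketbra_mul_ketbra (v : H) : ketbra v * ketbra v = ((‖v‖ ^ 2 : ℝ) : ℂ) • ketbra v := by
  ext x
  simp [smul_smul, inner_self_eq_norm_sq_to_K, mul_comm]

theorem ketbra_smul (c : ℂ) (v : H) : ketbra (c • v) = ((‖c‖ ^ 2 : ℝ) : ℂ) • ketbra v := by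
  ext x
  simp only [InnerProductSpace.rankOne_apply, inner_smul_left, smul_smul,
    smul_apply, Complex.ofReal_pow]
  rw [← Complex.mul_conj']
  congr 1
  ring

theorem re_inner_star_apply (T : H →L[ℂ] H) (v : H) :
    (⟪v, star T v⟫_ℂ).re = (⟪v, T v⟫_ℂ).re := by
  rw [ContinuousLinearMap.star_eq_adjoint, ContinuousLinearMap.adjoint_inner_right]
  exact inner_re_symm (𝕜 := ℂ) _ _

theorem isPositive_iff_star {T : H →L[ℂ] H} :
    T.IsPositive ↔ star T = T ∧ ∀ v, 0 ≤ (⟪v, T v⟫_ℂ).re := by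
  rw [ContinuousLinearMap.isPositive_def', IsSelfAdjoint]
  refine and_congr_right fun _ => forall_congr' fun v => ?_
  rw [ContinuousLinearMap.reApplyInnerSelf_apply, inner_re_symm]
  rfl

theorem inner_apply_comm {T : H →L[ℂ] H} (hT : T.IsPositive) (x y : H) :
    ⟪x, T y⟫_ℂ = ⟪T x, y⟫_ℂ :=
  (hT.inner_left_eq_inner_right x y).symm

/-- A positive operator kills the vectors on which its quadratic form vanishes. -/
theorem apply_eq_zero_of_re_inner {T : H →L[ℂ] H} (hT : T.IsPositive) {v : H}
    (h : (⟪v, T v⟫_ℂ).re = 0) : T v = 0 := by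
  have hs : CFC.sqrt T * CFC.sqrt T = T :=
    CFC.sqrt_mul_sqrt_self T ((ContinuousLinearMap.nonneg_iff_isPositive T).2 hT)
  have hp : (CFC.sqrt T).IsPositive :=
    (ContinuousLinearMap.nonneg_iff_isPositive _).1 (CFC.sqrt_nonneg T)
  -- The quadratic form at v is ‖√T v‖².
  have h0 : CFC.sqrt T v = 0 := by
    rw [← hs, mul_apply_eq_comp, inner_apply_comm hp] at h
    exact (inner_self_eq_zero (𝕜 := ℂ)).1 (Complex.ext h (inner_self_im (𝕜 := ℂ) _))
  rw [← hs, mul_apply_eq_comp, h0, map_zero]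

section FiniteDimensional

variable [FiniteDimensional ℂ H]

theorem opTrace_mul_ketbra (T : H →L[ℂ] H) (v : H) : opTrace (T * ketbra v) = ⟪v, T v⟫_ℂ := by
  rw [mul_ketbra, opTrace_apply, InnerProductSpace.trace_rankOne]

theorem opTrace_ketbra (v : H) : opTrace (ketbra v) = ((‖v‖ ^ 2 : ℝ) : ℂ) := by
  rw [opTrace_apply, InnerProductSpace.trace_rankOne, inner_self_eq_norm_sq_to_K]
  simp

theorem exists_eq_sum_ketbra {T : H →L[ℂ] H} (hT : T.IsPositive) :
    ∃ (n : ℕ) (u : Fin n → H), T = ∑ i, ketbra (u i) := by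
  obtain ⟨n, u, h⟩ := ContinuousLinearMap.isPositive_iff_eq_sum_rankOne.1 hT
  exact ⟨n, u, h⟩

/-- With T = ∑ |u_i⟩⟨u_i| the trace is ∑ ⟪u_i, S u_i⟫. -/
theorem re_opTrace_mul_nonneg {S T : H →L[ℂ] H} (hS : S.IsPositive) (hT : T.IsPositive) :
    0 ≤ (opTrace (S * T)).re := by
  obtain ⟨n, u, rfl⟩ := exists_eq_sum_ketbra hT
  rw [Finset.mul_sum, map_sum, Complex.re_sum]
  exact Finset.sum_nonneg fun i _ => by
    rw [opTrace_mul_ketbra]; exact (isPositive_iff_star.1 hS).2 _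

theorem mul_eq_zero_of_re_opTrace {S T : H →L[ℂ] H} (hS : S.IsPositive) (hT : T.IsPositive)
    (h : (opTrace (S * T)).re = 0) : S * T = 0 := by
  obtain ⟨n, u, rfl⟩ := exists_eq_sum_ketbra hT
  rw [Finset.mul_sum, map_sum, Complex.re_sum,
    Finset.sum_eq_zero_iff_of_nonneg fun i _ => by
      rw [opTrace_mul_ketbra]; exact (isPositive_iff_star.1 hS).2 _] at h
  rw [Finset.mul_sum]
  refine Finset.sum_eq_zero fun i hi => ?_
  have := h i hi
  rw [opTrace_mul_ketbra] at this
  rw [mul_ketbra, apply_eq_zero_of_re_inner hS this, map_zero]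
  rfl

end FiniteDimensional

/-! ### Existence of optimal measurements -/

theorem Ensemble.weighted_pos (P : Ensemble H ι) (i : ι) : (P.weighted i).IsPositive :=
  (P.state_pos i).smul_of_nonneg (Complex.zero_le_real.2 (P.prob_pos i).le)

theorem Ensemble.opTrace_weighted (P : Ensemble H ι) (i : ι) :
    opTrace (P.weighted i) = P.prob i := by
  rw [weighted, map_smul, opTrace_apply, P.state_trace, smul_eq_mul, mul_one]

theorem Ensemble.range_weighted (P : Ensemble H ι) (i : ι) :
    (P.weighted i : H →ₗ[ℂ] H).range = (P.state i : H →ₗ[ℂ] H).range := by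
  rw [weighted, ContinuousLinearMap.toLinearMap_smul]
  exact LinearMap.range_smul _ _ (Complex.ofReal_ne_zero.2 (P.prob_pos i).ne')

theorem successProb_eq (P : Ensemble H ι) (E : POVM H ι) :
    successProb P E = ∑ i, (opTrace (P.weighted i * E.elem i)).re := by
  refine Finset.sum_congr rfl fun i _ => ?_
  rw [Ensemble.weighted, smul_mul_assoc, map_smul, smul_eq_mul, Complex.re_ofReal_mul,
    opTrace_apply]

theorem POVM.elem_nonneg (E : POVM H ι) (i : ι) : 0 ≤ E.elem i :=
  (ContinuousLinearMap.nonneg_iff_isPositive _).2 (E.elem_pos i)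

theorem POVM.elem_le_one (E : POVM H ι) (i : ι) : E.elem i ≤ 1 := by
  rw [← E.elem_sum]
  exact Finset.single_le_sum (fun j _ => E.elem_nonneg j) (Finset.mem_univ i)

/-- The measurements form a compact set, bounded because 0 ≤ E_i ≤ 1, and the success probability is
continuous on it. -/
theorem exists_isOptimal [FiniteDimensional ℂ H] [Nonempty ι] (P : Ensemble H ι) :
    ∃ E, IsOptimal P E := by
  classical
  let K : Set (ι → H →L[ℂ] H) := {f | (∀ i, 0 ≤ f i) ∧ ∑ i, f i = 1}
  have hK : ∀ f, f ∈ K → ∃ E : POVM H ι, E.elem = f := fun f hf =>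
    ⟨⟨f, fun i => (ContinuousLinearMap.nonneg_iff_isPositive _).1 (hf.1 i), hf.2⟩, rfl⟩
  have hclosed : IsClosed K := by
    refine IsClosed.inter ?_ (isClosed_eq (by fun_prop) continuous_const)
    exact isClosed_Ici (a := (0 : ι → H →L[ℂ] H))
  have hbdd : Bornology.IsBounded K := by
    refine (Metric.isBounded_closedBall (x := 0) (r := ‖(1 : H →L[ℂ] H)‖)).subset fun f hf => ?_
    obtain ⟨E, rfl⟩ := hK f hf
    rw [mem_closedBall_zero_iff, pi_norm_le_iff_of_nonneg (norm_nonneg _)]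
    exact fun i => CStarAlgebra.norm_le_norm_of_nonneg_of_le (E.elem_nonneg i) (E.elem_le_one i)
  have : ProperSpace (H →L[ℂ] H) := FiniteDimensional.proper ℂ _
  have hcomp : IsCompact K := Metric.isCompact_of_isClosed_isBounded hclosed hbdd
  have hne : K.Nonempty := by
    refine ⟨fun i => if i = Classical.arbitrary ι then 1 else 0, fun i => ?_, by simp⟩
    dsimp only
    split_ifs
    exacts [zero_le_one, le_rfl]
  have hcont : Continuous fun f : ι → H →L[ℂ] H =>
      ∑ i, (opTrace (P.weighted i * f i)).re := by
    refine continuous_finsetSum _ fun i _ => Complex.continuous_re.comp ?_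
    exact (LinearMap.continuous_of_finiteDimensional (opTrace (H := H))).comp
      (continuous_const.mul (continuous_apply i))
  obtain ⟨f, hf, hmax⟩ := hcomp.exists_isMaxOn hne hcont.continuousOn
  obtain ⟨E, rfl⟩ := hK f hf
  refine ⟨E, fun E' => ?_⟩
  rw [successProb_eq, successProb_eq]
  exact hmax ⟨E'.elem_nonneg, E'.elem_sum⟩

/-! ### The optimality conditions -/

/-- `Z` certifies the optimality of the measurement `E`: it dominates all the weighted states, and
agrees with the `i`-th one on the range of `E i`. -/
structure IsDualCert (P : Ensemble H ι) (E : POVM H ι) (Z : H →L[ℂ] H) : Prop where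
  sub_pos : ∀ i, (Z - P.weighted i).IsPositive
  mul_eq : ∀ i, Z * E.elem i = P.weighted i * E.elem i

section FiniteDimensional

variable [FiniteDimensional ℂ H]

/-- The duality gap as a sum of terms that are nonnegative as soon as Z dominates every weighted
state. -/
theorem opTrace_sub_successProb (P : Ensemble H ι) (E : POVM H ι) (Z : H →L[ℂ] H) :
    ∑ i, (opTrace ((Z - P.weighted i) * E.elem i)).re = (opTrace Z).re - successProb P E := by
  rw [successProb_eq]
  simp only [sub_mul, map_sub, Complex.sub_re, Finset.sum_sub_distrib]
  rw [← Complex.re_sum, ← map_sum, ← Finset.mul_sum, E.elem_sum, mul_one]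

theorem IsDualCert.successProb_eq {P : Ensemble H ι} {E : POVM H ι} {Z : H →L[ℂ] H}
    (h : IsDualCert P E Z) : successProb P E = (opTrace Z).re := by
  have := opTrace_sub_successProb P E Z
  simp only [sub_mul, h.mul_eq, sub_self, map_zero, Complex.zero_re, Finset.sum_const_zero] at this
  linarith

theorem IsDualCert.isOptimal {P : Ensemble H ι} {E : POVM H ι} {Z : H →L[ℂ] H}
    (h : IsDualCert P E Z) : IsOptimal P E := fun E' => by
  rw [h.successProb_eq, ← sub_nonneg, ← opTrace_sub_successProb]
  exact Finset.sum_nonneg fun i _ => re_opTrace_mul_nonneg (h.sub_pos i) (E'.elem_pos i)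

/-- Complementary slackness: when the gap vanishes, so does each nonnegative term Tr((Z - R_i) E_i),
and a product of positive operators with trace zero is zero. -/
theorem isDualCert_of_opTrace_eq {P : Ensemble H ι} {E : POVM H ι} {Z : H →L[ℂ] H}
    (hZ : ∀ i, (Z - P.weighted i).IsPositive) (h : (opTrace Z).re = successProb P E) :
    IsDualCert P E Z := by
  refine ⟨hZ, fun i => ?_⟩
  have h0 := opTrace_sub_successProb P E Z
  rw [h, sub_self, Finset.sum_eq_zero_iff_of_nonneg fun i _ =>
    re_opTrace_mul_nonneg (hZ i) (E.elem_pos i)] at h0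
  rw [← sub_eq_zero, ← sub_mul]
  exact mul_eq_zero_of_re_opTrace (hZ i) (E.elem_pos i) (h0 i (Finset.mem_univ i))

/-- Domination does not involve the measurement, and all optimal measurements share the value Tr Z.
-/
theorem IsDualCert.of_isOptimal {P : Ensemble H ι} {E E' : POVM H ι} {Z : H →L[ℂ] H}
    (h : IsDualCert P E Z) (h' : IsOptimal P E') : IsDualCert P E' Z :=
  isDualCert_of_opTrace_eq h.sub_pos
    (h.successProb_eq.symm.trans (le_antisymm (h' E) (h.isOptimal E')))

/-- The measurement obtained from `E` by damping all its elements along `v` and adding the loss to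
the `k`-th one. -/
noncomputable def POVM.perturb [DecidableEq ι] (E : POVM H ι) (k : ι) (v : H) (ε : ℝ) (h0 : 0 ≤ ε)
    (h1 : ε * ‖v‖ ^ 2 ≤ 2) : POVM H ι where
  -- For K = |v⟩⟨v| one has (1 - εK)² = 1 - (2ε - ε²‖v‖²)K, so the second summand restores the
  -- total; its coefficient is nonnegative by `h1`.
  elem i := (1 - (ε : ℂ) • ketbra v) * E.elem i * (1 - (ε : ℂ) • ketbra v) +
    if i = k then ((2 * ε - ε ^ 2 * ‖v‖ ^ 2 : ℝ) : ℂ) • ketbra v else 0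
  elem_pos i := by
    refine ContinuousLinearMap.IsPositive.add ?_ ?_
    · have hs : star (1 - (ε : ℂ) • ketbra v) = 1 - (ε : ℂ) • ketbra v := by
        have : star (ketbra v) = ketbra v :=
          (isPositive_iff_star.1 (InnerProductSpace.isPositive_rankOne_self v)).1
        rw [star_sub, star_one, star_smul, this]
        simp
      have := (E.elem_pos i).conj_adjoint (1 - (ε : ℂ) • ketbra v)
      rwa [← ContinuousLinearMap.star_eq_adjoint, hs] at this
    · split_ifs
      · refine (InnerProductSpace.isPositive_rankOne_self v).smul_of_nonneg
          (Complex.zero_le_real.2 ?_)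
        nlinarith
      · exact ContinuousLinearMap.isPositive_zero
  elem_sum := by
    rw [Finset.sum_add_distrib, ← Finset.sum_mul, ← Finset.mul_sum, E.elem_sum,
      Finset.sum_ite_eq' Finset.univ k, if_pos (Finset.mem_univ k)]
    have := ketbra_mul_ketbra v
    simp only [mul_one, mul_sub, sub_mul, one_mul, smul_mul_assoc, mul_smul_comm, this]
    push_cast
    module

/-- First-order condition at the optimum: perturbing along v in favour of outcome k changes the
success probability by 2ε(c - a) + ε²(b - sc), which is at most 0 for all small ε > 0. -/
theorem re_inner_le_of_isOptimal {P : Ensemble H ι} {E : POVM H ι} (hE : IsOptimal P E) (k : ι)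
    (v : H) : (⟪v, P.weighted k v⟫_ℂ).re ≤ (⟪v, (∑ i, P.weighted i * E.elem i) v⟫_ℂ).re := by
  classical
  set s : ℝ := ‖v‖ ^ 2 with hs
  set c : ℝ := (⟪v, P.weighted k v⟫_ℂ).re with hc
  set a : ℝ := (⟪v, (∑ i, P.weighted i * E.elem i) v⟫_ℂ).re with ha
  set b : ℝ := ∑ i, (opTrace (P.weighted i * (ketbra v * (E.elem i * ketbra v)))).re with hb
  have hs0 : 0 ≤ s := by positivity
  have hexp : ∀ ε : ℝ, 0 < ε → ε * s ≤ 2 → 2 * (c - a) ≤ ε * (s * c - b) := by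
    intro ε h0 h1
    have hterm : ∀ i, (opTrace (P.weighted i * (E.perturb k v ε h0.le h1).elem i)).re =
        (opTrace (P.weighted i * E.elem i)).re
        - 2 * ε * (⟪v, (P.weighted i * E.elem i) v⟫_ℂ).re
        + ε ^ 2 * (opTrace (P.weighted i * (ketbra v * (E.elem i * ketbra v)))).re
        + if i = k then (2 * ε - ε ^ 2 * s) * c else 0 := by
      intro i
      -- Cyclicity turns this trace into ⟪v, E_i R_i v⟫, and E_i R_i is the adjoint of R_i E_i.
      have h2 : (opTrace (P.weighted i * (ketbra v * E.elem i))).re =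
          (⟪v, (P.weighted i * E.elem i) v⟫_ℂ).re := by
        rw [opTrace_mul_comm, mul_assoc, opTrace_mul_comm, opTrace_mul_ketbra,
          ← re_inner_star_apply, star_mul, (isPositive_iff_star.1 (P.weighted_pos i)).1,
          (isPositive_iff_star.1 (E.elem_pos i)).1]
      have h3 : (opTrace (P.weighted i * (E.elem i * ketbra v))).re =
          (⟪v, (P.weighted i * E.elem i) v⟫_ℂ).re := by
        rw [← mul_assoc, opTrace_mul_ketbra]
      have h4 : (opTrace (P.weighted i *
          if i = k then ((2 * ε - ε ^ 2 * s : ℝ) : ℂ) • ketbra v else 0)).re =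
          if i = k then (2 * ε - ε ^ 2 * s) * c else 0 := by
        split_ifs with h
        · rw [mul_smul_comm, map_smul, opTrace_mul_ketbra, smul_eq_mul, Complex.re_ofReal_mul, h]
        · simp
      have h5 : (1 - (ε : ℂ) • ketbra v) * E.elem i * (1 - (ε : ℂ) • ketbra v) =
          E.elem i - (ε : ℂ) • (ketbra v * E.elem i) - (ε : ℂ) • (E.elem i * ketbra v)
            + ((ε ^ 2 : ℝ) : ℂ) • (ketbra v * (E.elem i * ketbra v)) := by
        simp only [mul_one, mul_sub, sub_mul, one_mul, smul_mul_assoc, mul_smul_comm, mul_assoc]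
        push_cast
        module
      change (opTrace (P.weighted i * (_ + _))).re = _
      rw [mul_add, map_add, Complex.add_re, h4, h5]
      simp only [mul_add, mul_sub, mul_smul_comm, map_add, map_sub, map_smul, smul_eq_mul,
        Complex.add_re, Complex.sub_re, Complex.re_ofReal_mul, h2, h3]
      ring
    have hle := hE (E.perturb k v ε h0.le h1)
    rw [successProb_eq, successProb_eq, Finset.sum_congr rfl fun i _ => hterm i,
      Finset.sum_add_distrib, Finset.sum_add_distrib, Finset.sum_sub_distrib,
      Finset.sum_ite_eq' Finset.univ k, if_pos (Finset.mem_univ k), ← Finset.mul_sum,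
      ← Finset.mul_sum, ← hb] at hle
    have ha' : a = ∑ i, (⟪v, (P.weighted i * E.elem i) v⟫_ℂ).re := by
      rw [ha, sum_apply, inner_sum, Complex.re_sum]
    rw [← ha'] at hle
    have : ε * (2 * (c - a)) ≤ ε * (ε * (s * c - b)) := by nlinarith
    exact le_of_mul_le_mul_left this h0
  by_contra! hlt
  -- D makes ε = (c - a)/D admissible, as εs ≤ 1, and small enough that ε(sc - b) ≤ c - a < 2(c -
  -- a).
  set D : ℝ := |s * c - b| + (c - a) * s + 1 with hD
  have hd : 0 < c - a := by linarith
  have hD0 : 0 < D := by positivity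
  have h := hexp ((c - a) / D) (by positivity) (by
    rw [div_mul_eq_mul_div, div_le_iff₀ hD0]
    nlinarith [abs_nonneg (s * c - b), mul_nonneg hd.le hs0])
  rw [div_mul_eq_mul_div, le_div_iff₀ hD0] at h
  have hDle : s * c - b ≤ D := by
    nlinarith [le_abs_self (s * c - b), mul_nonneg hd.le hs0]
  nlinarith [mul_le_mul_of_nonneg_left hDle hd.le, mul_pos hd hD0]

/-- The Hermitian part of Y = ∑ R_i E_i works: it has the same real quadratic form as Y, hence the
same real trace, which is the success probability. -/
theorem IsOptimal.exists_isDualCert {P : Ensemble H ι} {E : POVM H ι} (hE : IsOptimal P E) :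
    ∃ Z, IsDualCert P E Z := by
  set Y := ∑ i, P.weighted i * E.elem i with hY
  have hre : ∀ v, (⟪v, ((1 / 2 : ℂ) • (Y + star Y)) v⟫_ℂ).re = (⟪v, Y v⟫_ℂ).re := fun v => by
    have h2 : (1 / 2 : ℂ) = ((1 / 2 : ℝ) : ℂ) := by norm_num
    rw [h2, smul_apply, inner_smul_right, Complex.re_ofReal_mul,
      add_apply, inner_add_right, Complex.add_re, re_inner_star_apply]
    ring
  refine ⟨(1 / 2 : ℂ) • (Y + star Y), isDualCert_of_opTrace_eq (fun k => ?_) ?_⟩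
  · rw [isPositive_iff_star]
    refine ⟨?_, fun v => ?_⟩
    · rw [star_sub, (isPositive_iff_star.1 (P.weighted_pos k)).1, star_smul, star_add, star_star,
        add_comm]
      simp
    · rw [sub_apply, inner_sub_right, Complex.sub_re, hre, sub_nonneg]
      exact re_inner_le_of_isOptimal hE k v
  · have hb := LinearMap.trace_eq_sum_inner (𝕜 := ℂ) (E := H) (b := stdOrthonormalBasis ℂ H)
    rw [successProb_eq, ← Complex.re_sum, ← map_sum, ← hY, opTrace_apply, opTrace_apply, hb, hb,
      Complex.re_sum, Complex.re_sum]
    exact Finset.sum_congr rfl fun i _ => hre _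

end FiniteDimensional

end

section

variable {H : Type*} [NormedAddCommGroup H] [InnerProductSpace ℂ H] [CompleteSpace H]
  {ι : Type*} [Fintype ι]

/-! ### Optimal measurements of linearly independent ensembles -/

theorem Ensemble.IsLI.eq_of_sum_eq {P : Ensemble H ι} {r : ι → ℕ} (hP : P.IsLI r) {v w : ι → H}
    (hv : ∀ i, v i ∈ (P.weighted i : H →ₗ[ℂ] H).range)
    (hw : ∀ i, w i ∈ (P.weighted i : H →ₗ[ℂ] H).range) (h : ∑ i, v i = ∑ i, w i) (i : ι) :
    v i = w i := by
  simp only [P.range_weighted] at hv hw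
  exact (iSupIndep_iff_finsetSum_eq_imp_eq _).1 hP.indep Finset.univ v w
    (fun i _ => ⟨hv i, hw i⟩) h i (Finset.mem_univ i)

theorem Ensemble.nonempty (P : Ensemble H ι) : Nonempty ι := by
  by_contra h
  rw [not_nonempty_iff] at h
  simpa using P.prob_sum

theorem IsDualCert.isPositive {P : Ensemble H ι} {E : POVM H ι} {Z : H →L[ℂ] H}
    (h : IsDualCert P E Z) : Z.IsPositive := by
  obtain ⟨i⟩ := P.nonempty
  simpa using (h.sub_pos i).add (P.weighted_pos i)

/-- From 0 ≤ R_i ≤ Z, a vector killed by Z is killed by every R_i, hence orthogonal to all the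
supports, which span H. -/
theorem IsDualCert.injective {P : Ensemble H ι} {E : POVM H ι} {Z : H →L[ℂ] H}
    (h : IsDualCert P E Z) {r : ι → ℕ} (hP : P.IsLI r) : Function.Injective Z := by
  rw [injective_iff_map_eq_zero]
  intro v hv
  have hR : ∀ i, P.weighted i v = 0 := fun i => by
    refine apply_eq_zero_of_re_inner (P.weighted_pos i) (le_antisymm ?_ ?_)
    · have := (isPositive_iff_star.1 (h.sub_pos i)).2 v
      rw [sub_apply, hv, zero_sub, inner_neg_right, Complex.neg_re] at this
      linarith
    · exact (isPositive_iff_star.1 (P.weighted_pos i)).2 v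
  have htop : ⨆ i, (P.state i : H →ₗ[ℂ] H).range ≤ (ℂ ∙ v)ᗮ := by
    refine iSup_le fun i => ?_
    rw [← P.range_weighted]
    rintro _ ⟨x, rfl⟩
    rw [Submodule.mem_orthogonal_singleton_iff_inner_right]
    change ⟪v, P.weighted i x⟫_ℂ = 0
    rw [inner_apply_comm (P.weighted_pos i), hR, inner_zero_left]
  rw [hP.span, top_le_iff, Submodule.orthogonal_eq_top_iff, Submodule.span_singleton_eq_bot] at htop
  exact htop

variable [FiniteDimensional ℂ H]

theorem isUnit_of_injective {Z : H →L[ℂ] H} (h : Function.Injective Z) : IsUnit Z :=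
  ContinuousLinearMap.isUnit_iff_bijective.2
    ⟨h, LinearMap.injective_iff_surjective.1 (show Function.Injective (Z : H →ₗ[ℂ] H) from h)⟩

/-- The vectors Z E_i E'_j y = R_i E_i E'_j y lie in the independent supports and sum to Z E'_j y,
which already lies in the j-th one. So the terms with i ≠ j vanish, and Z is injective. -/
theorem IsDualCert.mul_elem_of_ne {P : Ensemble H ι} {E E' : POVM H ι} {Z : H →L[ℂ] H}
    (h : IsDualCert P E Z) (h' : IsDualCert P E' Z) {r : ι → ℕ} (hP : P.IsLI r) {i j : ι}
    (hij : i ≠ j) : E.elem i * E'.elem j = 0 := by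
  classical
  ext y
  have := hP.eq_of_sum_eq (v := fun i => Z (E.elem i (E'.elem j y)))
    (w := fun i => if i = j then Z (E'.elem j y) else 0)
    (fun i => ⟨E.elem i (E'.elem j y),
      (DFunLike.congr_fun (h.mul_eq i) (E'.elem j y)).symm⟩)
    (fun i => by
      split_ifs with hi
      · subst hi
        exact ⟨E'.elem i y, (DFunLike.congr_fun (h'.mul_eq i) y).symm⟩
      · exact zero_mem _)
    (by
      rw [Finset.sum_ite_eq' Finset.univ j, if_pos (Finset.mem_univ j), ← map_sum]
      simp_rw [← sum_apply]
      rw [E.elem_sum]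
      rfl) i
  rw [if_neg hij] at this
  exact (injective_iff_map_eq_zero Z).1 (h.injective hP) _ this

/-- Insert the resolution of the identity by E' or by E. The case E' = E shows that the elements are
projections. -/
theorem IsDualCert.mul_elem_self {P : Ensemble H ι} {E E' : POVM H ι} {Z : H →L[ℂ] H}
    (h : IsDualCert P E Z) (h' : IsDualCert P E' Z) {r : ι → ℕ} (hP : P.IsLI r) (i : ι) :
    E.elem i * E'.elem i = E.elem i ∧ E.elem i * E'.elem i = E'.elem i := by
  constructor
  · conv_rhs => rw [← mul_one (E.elem i), ← E'.elem_sum, Finset.mul_sum]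
    exact (Finset.sum_eq_single i (fun j _ hj => h.mul_elem_of_ne h' hP hj.symm) (by simp)).symm
  · conv_rhs => rw [← one_mul (E'.elem i), ← E.elem_sum, Finset.sum_mul]
    exact (Finset.sum_eq_single i (fun j _ hj => h.mul_elem_of_ne h' hP hj) (by simp)).symm

/-- The optimal measurement of a linearly independent ensemble is unique. -/
theorem IsDualCert.isOptimal_iff {P : Ensemble H ι} {E : POVM H ι} {Z : H →L[ℂ] H}
    (h : IsDualCert P E Z) {r : ι → ℕ} (hP : P.IsLI r) (E' : POVM H ι) :
    IsOptimal P E' ↔ E' = E := by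
  refine ⟨fun hE' => ?_, fun hE' => hE' ▸ h.isOptimal⟩
  have h' := h.of_isOptimal hE'
  ext1
  funext i
  exact (h.mul_elem_self h' hP i).2.symm.trans (h.mul_elem_self h' hP i).1

/-- The optimal measurement `E` of `P` in a basis adapted to `P`: with respect to the orthonormal
basis `w`, which splits the elements of `E` into rank-one projections, the diagonal blocks of the
operator `Z` are diagonal with the positive entries `a`, and the vectors `Z (w ⟨i, j⟩)` decompose
the weighted states. -/
structure IsFrame {r : ι → ℕ} (P : Ensemble H ι) (E : POVM H ι) (Z : H →L[ℂ] H)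
    (w : (i : ι) × Fin (r i) → H) (a : (i : ι) × Fin (r i) → ℝ) : Prop where
  cert : IsDualCert P E Z
  isUnit : IsUnit Z
  isOptimal_iff : ∀ E', IsOptimal P E' ↔ E' = E
  orthonormal : Orthonormal ℂ w
  elem_eq : ∀ i, E.elem i = ∑ j, ketbra (w ⟨i, j⟩)
  pos : ∀ b, 0 < a b
  inner_eq : ∀ i j k, ⟪w ⟨i, j⟩, Z (w ⟨i, k⟩)⟫_ℂ = if j = k then (a ⟨i, j⟩ : ℂ) else 0
  weighted_eq : ∀ i, P.weighted i = ∑ j, ((a ⟨i, j⟩)⁻¹ : ℂ) • ketbra (Z (w ⟨i, j⟩))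

/-- Expand R_i x = ∑_k Z E_k Y R_i x; the k-th term lies in the support of R_k, so only k = i
survives. Thus Z carries the range of E_i bijectively onto the support of R_i. -/
theorem IsDualCert.finrank_range {P : Ensemble H ι} {E : POVM H ι} {Z Y : H →L[ℂ] H}
    (h : IsDualCert P E Z) {r : ι → ℕ} (hP : P.IsLI r) (hZY : Z * Y = 1) (i : ι) :
    P.weighted i = Z * E.elem i * Y * P.weighted i ∧
      Module.finrank ℂ (E.elem i : H →ₗ[ℂ] H).range = r i := by
  classical
  have hZ := h.injective hP
  have h1 : P.weighted i = Z * E.elem i * Y * P.weighted i := by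
    ext x
    have := hP.eq_of_sum_eq (v := fun k => if k = i then P.weighted i x else 0)
      (w := fun k => Z (E.elem k (Y (P.weighted i x))))
      (fun k => by
        split_ifs with hk
        · subst hk
          exact ⟨x, rfl⟩
        · exact zero_mem _)
      (fun k => ⟨E.elem k (Y (P.weighted i x)),
        (DFunLike.congr_fun (h.mul_eq k) (Y (P.weighted i x))).symm⟩)
      (by
        rw [Finset.sum_ite_eq' Finset.univ i, if_pos (Finset.mem_univ i), ← map_sum]
        simp_rw [← sum_apply]
        rw [E.elem_sum]
        exact (DFunLike.congr_fun hZY (P.weighted i x)).symm) i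
    rwa [if_pos rfl] at this
  refine ⟨h1, ?_⟩
  have hrange : (P.weighted i : H →ₗ[ℂ] H).range =
      (E.elem i : H →ₗ[ℂ] H).range.map (Z : H →ₗ[ℂ] H) := by
    apply le_antisymm
    · rintro _ ⟨x, rfl⟩
      exact ⟨_, ⟨Y (P.weighted i x), rfl⟩, (DFunLike.congr_fun h1 x).symm⟩
    · rintro _ ⟨_, ⟨x, rfl⟩, rfl⟩
      exact ⟨E.elem i x, (DFunLike.congr_fun (h.mul_eq i) x).symm⟩
  rw [← hP.rank i, ← P.range_weighted, hrange]
  exact (Submodule.equivMapOfInjective (Z : H →ₗ[ℂ] H) hZ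
    (E.elem i : H →ₗ[ℂ] H).range).finrank_eq

/-- The compression of a positive operator to the range of a projection is diagonal in a suitable
orthonormal basis of the range. -/
theorem exists_orthonormal_eigenvectors {T Z : H →L[ℂ] H} (hT : T.IsPositive) (hTT : T * T = T)
    (hZ : Z.IsPositive) {n : ℕ} (hn : Module.finrank ℂ (T : H →ₗ[ℂ] H).range = n) :
    ∃ (w : Fin n → H) (a : Fin n → ℝ), Orthonormal ℂ w ∧ T = ∑ j, ketbra (w j) ∧
      (∀ j, T (w j) = w j) ∧ ∀ j, T (Z (w j)) = (a j : ℂ) • w j := by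
  have hfix : ∀ x ∈ (T : H →ₗ[ℂ] H).range, T x = x := by
    rintro _ ⟨x, rfl⟩
    exact DFunLike.congr_fun hTT x
  let S : (T : H →ₗ[ℂ] H).range →ₗ[ℂ] (T : H →ₗ[ℂ] H).range :=
    (T : H →ₗ[ℂ] H).rangeRestrict ∘ₗ (Z : H →ₗ[ℂ] H) ∘ₗ (T : H →ₗ[ℂ] H).range.subtype
  have hcoe : ∀ x, (S x : H) = T (Z x) := fun x => rfl
  have hS : S.IsSymmetric := fun x y => by
    rw [Submodule.coe_inner, Submodule.coe_inner, hcoe, hcoe, ← inner_apply_comm hT,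
      hfix y y.2, inner_apply_comm hT, hfix x x.2, inner_apply_comm hZ]
  have hw : ∀ j, T (hS.eigenvectorBasis hn j) = hS.eigenvectorBasis hn j := fun j =>
    hfix _ (hS.eigenvectorBasis hn j).2
  refine ⟨fun j => hS.eigenvectorBasis hn j, hS.eigenvalues hn,
    (hS.eigenvectorBasis hn).orthonormal.comp_linearIsometry
      (T : H →ₗ[ℂ] H).range.subtypeₗᵢ, ?_, hw, fun j => ?_⟩
  · ext x
    have := congrArg Subtype.val ((hS.eigenvectorBasis hn).sum_repr' ⟨T x, x, rfl⟩)
    rw [sum_apply]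
    refine this.symm.trans ?_
    rw [Submodule.coe_sum]
    refine Finset.sum_congr rfl fun j _ => ?_
    rw [Submodule.coe_smul, Submodule.coe_inner, InnerProductSpace.rankOne_apply,
      inner_apply_comm hT, hw]
  · rw [← hcoe, hS.apply_eigenvectorBasis]
    rfl

theorem Ensemble.IsLI.exists_isFrame {P : Ensemble H ι} {r : ι → ℕ} (hP : P.IsLI r) :
    ∃ E Z w a, IsFrame (r := r) P E Z w a := by
  classical
  have := P.nonempty
  obtain ⟨E, hE⟩ := exists_isOptimal P
  obtain ⟨Z, h⟩ := hE.exists_isDualCert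
  have hZ := h.isPositive
  have hZinj := h.injective hP
  have hZu := isUnit_of_injective hZinj
  obtain ⟨Y, hZY, hYZ⟩ := isUnit_iff_exists.1 hZu
  have hYs : star Y = Y := by
    have hs := (isPositive_iff_star.1 hZ).1
    have : star Y * Z = 1 := by rw [← hs, ← star_mul, hZY, star_one]
    calc star Y = star Y * (Z * Y) := by rw [hZY, mul_one]
      _ = Y := by rw [← mul_assoc, this, one_mul]
  have hEE := fun i => (h.mul_elem_self h hP i).1
  choose w a hw hE_eq hEw hEZ using fun i => exists_orthonormal_eigenvectors (E.elem_pos i) (hEE i)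
    hZ (h.finrank_range hP hZY i).2
  have hinner : ∀ i j k, ⟪w i j, Z (w i k)⟫_ℂ = if j = k then (a i j : ℂ) else 0 := by
    intro i j k
    rw [← hEw i j, ← inner_apply_comm (E.elem_pos i), hEZ, inner_smul_right,
      orthonormal_iff_ite.1 (hw i)]
    split_ifs with hjk <;> simp [hjk]
  have hpos : ∀ i j, 0 < a i j := by
    intro i j
    have h1 := hinner i j j
    rw [if_pos rfl] at h1
    have h2 := (isPositive_iff_star.1 hZ).2 (w i j)
    -- If a_ij = 0, the form of Z vanishes at w_ij, so Z w_ij = 0, against injectivity.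
    refine lt_of_le_of_ne (by simpa [h1] using h2) fun h0 => ?_
    have h3 := apply_eq_zero_of_re_inner hZ (v := w i j) (by rw [h1, ← h0]; simp)
    exact (hw i).ne_zero j ((injective_iff_map_eq_zero Z).1 hZinj _ h3)
  refine ⟨E, Z, fun b => w b.1 b.2, fun b => a b.1 b.2, h, hZu, h.isOptimal_iff hP, ?_, hE_eq,
    fun b => hpos _ _, hinner, fun i => ?_⟩
  · rw [orthonormal_iff_ite]
    rintro ⟨i, j⟩ ⟨k, l⟩
    by_cases hik : i = k
    · subst hik
      simpa using orthonormal_iff_ite.1 (hw i) j l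
    · rw [if_neg (by simp [hik])]
      change ⟪w i j, w k l⟫_ℂ = 0
      rw [← hEw i j, ← hEw k l, ← inner_apply_comm (E.elem_pos i), ← mul_apply_eq_comp,
        h.mul_elem_of_ne h hP hik, zero_apply, inner_zero_right]
  · have hRY : P.weighted i = P.weighted i * Y * E.elem i * Z := by
      have := congrArg star (h.finrank_range hP hZY i).1
      simpa only [star_mul, (isPositive_iff_star.1 (P.weighted_pos i)).1, hYs,
        (isPositive_iff_star.1 hZ).1, (isPositive_iff_star.1 (E.elem_pos i)).1, mul_assoc]
        using this
    -- Z w_ij = R_i w_ij = R_i Y E_i Z w_ij = a_ij R_i Y w_ij.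
    have hRw : ∀ j, P.weighted i (Y (w i j)) = ((a i j)⁻¹ : ℂ) • Z (w i j) := by
      intro j
      have h1 := DFunLike.congr_fun (h.mul_eq i) (w i j)
      simp only [mul_apply_eq_comp, hEw] at h1
      have h2 := DFunLike.congr_fun hRY (w i j)
      simp only [mul_apply_eq_comp, hEZ, map_smul] at h2
      rw [h1, h2, smul_smul, inv_mul_cancel₀ (Complex.ofReal_ne_zero.2 (hpos i j).ne'), one_smul]
    ext x
    rw [hRY]
    simp only [mul_apply_eq_comp]
    conv_lhs => rw [hE_eq i]
    simp only [sum_apply, smul_apply, InnerProductSpace.rankOne_apply, map_sum, map_smul, hRw,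
      inner_apply_comm hZ]
    exact Finset.sum_congr rfl fun j _ => smul_comm _ _ _

end

section

variable {H : Type*} [NormedAddCommGroup H] [InnerProductSpace ℂ H] [CompleteSpace H]

/-! ### Dual families and Gram matrices -/

section Dual

variable {κ : Type*} [Fintype κ] [DecidableEq κ]

theorem eq_of_forall_inner_eq {ψ : κ → H} (hs : ⊤ ≤ Submodule.span ℂ (Set.range ψ)) {x y : H}
    (h : ∀ b, ⟪ψ b, x⟫_ℂ = ⟪ψ b, y⟫_ℂ) : x = y := by
  have hle : Submodule.span ℂ (Set.range ψ) ≤ (ℂ ∙ (x - y))ᗮ := by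
    rw [Submodule.span_le]
    rintro _ ⟨b, rfl⟩
    rw [SetLike.mem_coe, Submodule.mem_orthogonal_singleton_iff_inner_left, inner_sub_right, h,
      sub_self]
  have htop := top_le_iff.1 (hs.trans hle)
  rw [Submodule.orthogonal_eq_top_iff, Submodule.span_singleton_eq_bot] at htop
  exact sub_eq_zero.1 htop

theorem inner_dualFamily {ψ : κ → H} (hψ : LinearIndependent ℂ ψ) (b c : κ) :
    ⟪ψ b, dualFamily ψ c⟫_ℂ = if b = c then 1 else 0 := by
  have hdet : IsUnit (Matrix.gram ℂ ψ).det :=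
    isUnit_iff_ne_zero.2 (Matrix.det_gram_ne_zero_iff_linearIndependent.2 hψ)
  have := congrFun (congrFun (Matrix.mul_nonsing_inv _ hdet) b) c
  rw [Matrix.mul_apply, Matrix.one_apply] at this
  rw [← this, dualFamily, inner_sum]
  exact Finset.sum_congr rfl fun d _ => by rw [inner_smul_right, Matrix.gram_apply, mul_comm]

theorem inner_sum_smul_dualFamily {ψ : κ → H} (hψ : LinearIndependent ℂ ψ) (f : κ → ℂ) (b : κ) :
    ⟪ψ b, ∑ c, f c • dualFamily ψ c⟫_ℂ = f b := by
  rw [inner_sum]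
  simp [inner_smul_right, inner_dualFamily hψ]

theorem sum_inner_smul_dualFamily {ψ : κ → H} (hψ : LinearIndependent ℂ ψ)
    (hs : ⊤ ≤ Submodule.span ℂ (Set.range ψ)) (x : H) :
    ∑ c, ⟪ψ c, x⟫_ℂ • dualFamily ψ c = x :=
  eq_of_forall_inner_eq hs fun b => inner_sum_smul_dualFamily hψ _ b

/-- Polar decomposition of an invertible matrix `X`, written with `X * Xᴴ`. -/
theorem exists_unitary_sqrt_mul {X G : Matrix κ κ ℂ} (hG : G.PosDef) (hX : X * X.conjTranspose = G) :
    ∃ W ∈ Matrix.unitaryGroup κ ℂ, X = CFC.sqrt G * W := by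
  have hGn : 0 ≤ G := Matrix.nonneg_iff_posSemidef.2 hG.posSemidef
  have hS : CFC.sqrt G * CFC.sqrt G = G := CFC.sqrt_mul_sqrt_self G hGn
  have hSh : (CFC.sqrt G).conjTranspose = CFC.sqrt G :=
    (Matrix.nonneg_iff_posSemidef.1 (CFC.sqrt_nonneg G)).isHermitian
  have hdet : IsUnit (CFC.sqrt G).det := by
    have : IsUnit G.det := isUnit_iff_ne_zero.2 hG.det_pos.ne'
    rw [← hS, Matrix.det_mul] at this
    exact isUnit_of_mul_isUnit_left this
  refine ⟨(CFC.sqrt G)⁻¹ * X, ?_, ?_⟩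
  · rw [Matrix.mem_unitaryGroup_iff, Matrix.star_eq_conjTranspose, Matrix.conjTranspose_mul,
      Matrix.conjTranspose_nonsing_inv, hSh]
    calc (CFC.sqrt G)⁻¹ * X * (X.conjTranspose * (CFC.sqrt G)⁻¹)
        = (CFC.sqrt G)⁻¹ * (X * X.conjTranspose) * (CFC.sqrt G)⁻¹ := by
          simp only [mul_assoc]
      _ = ((CFC.sqrt G)⁻¹ * CFC.sqrt G) * (CFC.sqrt G * (CFC.sqrt G)⁻¹) := by
          rw [hX]
          generalize CFC.sqrt G = S at hS ⊢
          rw [← hS]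
          simp only [mul_assoc]
      _ = 1 := by rw [Matrix.nonsing_inv_mul _ hdet, Matrix.mul_nonsing_inv _ hdet, mul_one]
  · rw [← mul_assoc, Matrix.mul_nonsing_inv _ hdet, one_mul]

end Dual

variable {ι : Type*} [Fintype ι] {r : ι → ℕ}

/-- An ensemble that is a combination of the pure states of a basis is linearly independent. -/
theorem isLI_of_weighted_eq {Q : Ensemble H ι} {v : (i : ι) × Fin (r i) → H}
    {d : (i : ι) × Fin (r i) → ℂ} (hd : ∀ b, d b ≠ 0) (hv : LinearIndependent ℂ v)
    (hs : ⊤ ≤ Submodule.span ℂ (Set.range v))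
    (hQ : ∀ i, Q.weighted i = ∑ j, d ⟨i, j⟩ • ketbra (v ⟨i, j⟩)) : Q.IsLI r := by
  classical
  have hrange : ∀ i, (Q.state i : H →ₗ[ℂ] H).range =
      Submodule.span ℂ (Set.range fun j => v ⟨i, j⟩) := by
    intro i
    have happ : ∀ x, Q.weighted i x = ∑ j, (d ⟨i, j⟩ * ⟪v ⟨i, j⟩, x⟫_ℂ) • v ⟨i, j⟩ := fun x => by
      simp [hQ, sum_apply, smul_smul]
    rw [← Q.range_weighted]
    apply le_antisymm
    · rintro _ ⟨x, rfl⟩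
      change Q.weighted i x ∈ _
      rw [happ]
      exact sum_mem fun j _ => Submodule.smul_mem _ _ (Submodule.subset_span ⟨j, rfl⟩)
    · rw [Submodule.span_le]
      rintro _ ⟨j, rfl⟩
      -- The dual vector isolates the j-th term of the sum.
      refine ⟨(d ⟨i, j⟩)⁻¹ • dualFamily v ⟨i, j⟩, ?_⟩
      change Q.weighted i _ = _
      rw [happ, Finset.sum_eq_single j]
      · rw [inner_smul_right, inner_dualFamily hv, if_pos rfl, mul_one, mul_inv_cancel₀ (hd _),
          one_smul]
      · intro k _ hk
        rw [inner_smul_right, inner_dualFamily hv, if_neg (by simpa using hk), mul_zero, mul_zero,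
          zero_smul]
      · simp
  refine ⟨?_, ?_, fun i => ?_⟩
  · rw [iSupIndep_def]
    intro i
    have hdisj := hv.disjoint_span_image (s := {b | b.1 = i}) (t := {b | b.1 ≠ i})
      (Set.disjoint_left.2 fun b hb hb' => hb' hb)
    refine hdisj.mono ?_ (iSup₂_le fun k hk => ?_)
    · rw [hrange]
      refine Submodule.span_mono ?_
      rintro _ ⟨j, rfl⟩
      exact ⟨⟨i, j⟩, rfl, rfl⟩
    · rw [hrange]
      refine Submodule.span_mono ?_
      rintro _ ⟨j, rfl⟩
      exact ⟨⟨k, j⟩, hk, rfl⟩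
  · rw [← top_le_iff]
    refine hs.trans (Submodule.span_le.2 ?_)
    rintro _ ⟨⟨i, j⟩, rfl⟩
    refine Submodule.mem_iSup_of_mem i ?_
    rw [hrange]
    exact Submodule.subset_span ⟨j, rfl⟩
  · rw [hrange]
    exact (finrank_span_eq_card (hv.comp (Sigma.mk i) sigma_mk_injective)).trans
      (Fintype.card_fin _)

theorem mul_ketbra_mul {Z : H →L[ℂ] H} (hZ : Z.IsPositive) (v : H) :
    Z * ketbra v * Z = ketbra (Z v) := by
  ext x
  simp [inner_apply_comm hZ]

section FiniteDimensional

variable [FiniteDimensional ℂ H]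

/-- The normalizations in ℛ thus depend only on the operator, not on its decomposition. -/
theorem sum_norm_sq_eq {n : ℕ} (v : Fin n → H) :
    ∑ j, ‖v j‖ ^ 2 = (opTrace (∑ j, ketbra (v j))).re := by
  rw [map_sum, Complex.re_sum]
  exact Finset.sum_congr rfl fun j _ => by rw [opTrace_ketbra, Complex.ofReal_re]

/-- With T = c^(-1/2) Z the weighted states are T E_i T. They sum to T², whose inverse square root
is T⁻¹. -/
theorem pgm_eq {Q : Ensemble H ι} {E : POVM H ι} {Z : H →L[ℂ] H} (hZ : Z.IsPositive)
    (hZu : IsUnit Z) {c : ℝ} (hc : 0 < c)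
    (hQ : ∀ i, Q.weighted i = ((c⁻¹ : ℝ) : ℂ) • (Z * E.elem i * Z)) (i : ι) :
    pgm Q i = E.elem i := by
  set d : ℝ := (√c)⁻¹ with hd
  have hd0 : 0 < d := by positivity
  have hdd : ((c⁻¹ : ℝ) : ℂ) = (d : ℂ) * d := by
    rw [← Complex.ofReal_mul, hd, ← mul_inv, Real.mul_self_sqrt hc.le]
  set T : H →L[ℂ] H := (d : ℂ) • Z with hT
  have hTn : 0 ≤ T := (ContinuousLinearMap.nonneg_iff_isPositive _).2
    (hZ.smul_of_nonneg (Complex.zero_le_real.2 hd0.le))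
  have hTu : IsUnit T := by
    rw [hT, Algebra.smul_def]
    exact ((isUnit_iff_ne_zero.2 (Complex.ofReal_ne_zero.2 hd0.ne')).map
      (algebraMap ℂ (H →L[ℂ] H))).mul hZu
  obtain ⟨u, hu⟩ := hTu
  have hTp : IsStrictlyPositive T := ⟨hTn, u, hu⟩
  have hQT : ∀ i, Q.weighted i = T * E.elem i * T := fun i => by
    rw [hQ, hdd, hT]
    simp only [smul_mul_assoc, mul_smul_comm, smul_smul]
  have hsum : ∑ j, Q.weighted j = T ^ (2 : ℝ) := by
    rw [Finset.sum_congr rfl fun j _ => hQT j, ← Finset.sum_mul, ← Finset.mul_sum, E.elem_sum,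
      mul_one, ← pow_two, ← CFC.rpow_natCast T 2]
    norm_num
  have hinv : (∑ j, Q.weighted j) ^ (-(1 / 2) : ℝ) = ((u⁻¹ : (H →L[ℂ] H)ˣ) : H →L[ℂ] H) := by
    rw [hsum, CFC.rpow_rpow T _ _ two_ne_zero hTp, ← CFC.rpow_neg_one_eq_inv u (hu ▸ hTn), hu]
    norm_num
  rw [pgm, hinv, hQT, ← hu]
  simp [mul_assoc]

end FiniteDimensional

end

section

variable {H : Type*} [NormedAddCommGroup H] [InnerProductSpace ℂ H] [CompleteSpace H]
  [FiniteDimensional ℂ H] {ι : Type*} [Fintype ι] {r : ι → ℕ} {P : Ensemble H ι} {E : POVM H ι}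
  {Z : H →L[ℂ] H} {w : (i : ι) × Fin (r i) → H} {a : (i : ι) × Fin (r i) → ℝ}

/-! ### The map `ℛ` in an adapted frame -/

namespace IsFrame

theorem injective (h : IsFrame P E Z w a) : Function.Injective Z :=
  (ContinuousLinearMap.isUnit_iff_bijective.1 h.isUnit).1

theorem surjective (h : IsFrame P E Z w a) : Function.Surjective Z :=
  (ContinuousLinearMap.isUnit_iff_bijective.1 h.isUnit).2

theorem span_range (h : IsFrame P E Z w a) : Submodule.span ℂ (Set.range w) = ⊤ := by
  rw [eq_top_iff]
  intro x _
  have hx : x = ∑ i, ∑ j, ⟪w ⟨i, j⟩, x⟫_ℂ • w ⟨i, j⟩ := by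
    conv_lhs => rw [← one_apply_eq_self (F := H →L[ℂ] H) x, ← E.elem_sum]
    simp [h.elem_eq, sum_apply]
  rw [hx]
  exact sum_mem fun i _ => sum_mem fun j _ =>
    Submodule.smul_mem _ _ (Submodule.subset_span ⟨_, rfl⟩)

theorem card_eq (h : IsFrame P E Z w a) :
    Fintype.card ((i : ι) × Fin (r i)) = Module.finrank ℂ H :=
  (Module.finrank_eq_card_basis
    (Module.Basis.mk h.orthonormal.linearIndependent h.span_range.ge)).symm

theorem linearIndependent_map (h : IsFrame P E Z w a) : LinearIndependent ℂ fun b => Z (w b) :=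
  h.orthonormal.linearIndependent.map' (Z : H →ₗ[ℂ] H) (LinearMap.ker_eq_bot.2 h.injective)

theorem span_range_map (h : IsFrame P E Z w a) :
    ⊤ ≤ Submodule.span ℂ (Set.range fun b => Z (w b)) := by
  have : (Set.range fun b => Z (w b)) = (Z : H →ₗ[ℂ] H) '' Set.range w := by
    rw [← Set.range_comp]; rfl
  rw [this, Submodule.span_image, h.span_range, Submodule.map_top,
    LinearMap.range_eq_top.2 h.surjective]

theorem map_ne_zero (h : IsFrame P E Z w a) (b) : Z (w b) ≠ 0 := h.linearIndependent_map.ne_zero b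

theorem isLI {Q : Ensemble H ι} {d : (i : ι) × Fin (r i) → ℂ} (h : IsFrame P E Z w a)
    (hd : ∀ b, d b ≠ 0) (hQ : ∀ i, Q.weighted i = ∑ j, d ⟨i, j⟩ • ketbra (Z (w ⟨i, j⟩))) :
    Q.IsLI r :=
  isLI_of_weighted_eq hd h.linearIndependent_map h.span_range_map hQ

theorem nonempty_fin (h : IsFrame P E Z w a) (i : ι) : Nonempty (Fin (r i)) := by
  by_contra hr
  rw [not_nonempty_iff] at hr
  have h0 := P.opTrace_weighted i
  rw [h.weighted_eq, Finset.univ_eq_empty, Finset.sum_empty, map_zero] at h0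
  exact (P.prob_pos i).ne (by exact_mod_cast h0)

theorem sum_norm_sq_pos (h : IsFrame P E Z w a) (i : ι) : 0 < ∑ j, ‖Z (w ⟨i, j⟩)‖ ^ 2 := by
  have := h.nonempty_fin i
  exact Finset.sum_pos (fun j _ => by have := norm_pos_iff.2 (h.map_ne_zero ⟨i, j⟩); positivity)
    Finset.univ_nonempty

theorem sum_sum_norm_sq_pos (h : IsFrame P E Z w a) :
    0 < ∑ i, ∑ j, ‖Z (w ⟨i, j⟩)‖ ^ 2 := by
  have := P.nonempty
  exact Finset.sum_pos (fun i _ => h.sum_norm_sq_pos i) Finset.univ_nonempty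

theorem sum_ketbra_map {n : ℕ} (h : IsFrame P E Z w a) {i : ι} {v : Fin n → H}
    (hv : E.elem i = ∑ j, ketbra (v j)) : ∑ j, ketbra (Z (v j)) = Z * E.elem i * Z := by
  rw [hv, Finset.mul_sum, Finset.sum_mul]
  exact Finset.sum_congr rfl fun j _ => (mul_ketbra_mul h.cert.isPositive _).symm

theorem weighted_apply {n : ℕ} (h : IsFrame P E Z w a) {i : ι} {v : Fin n → H}
    (hv : Orthonormal ℂ v) (hE : E.elem i = ∑ j, ketbra (v j)) (j : Fin n) :
    P.weighted i (v j) = Z (v j) := by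
  have h1 : E.elem i (v j) = v j := by
    rw [hE, sum_apply]
    simp [orthonormal_iff_ite.1 hv]
  have := DFunLike.congr_fun (h.cert.mul_eq i) (v j)
  simpa only [mul_apply_eq_comp, h1] using this.symm

/-- The coefficients ⟪ψ_k, v_j⟫ are the entries of the diagonal block of X, so the left side is
χ_ij; it equals R_i v_j = Z v_j. -/
theorem sum_inner_smul {n l : ℕ} (h : IsFrame P E Z w a) {i : ι} {ψ : Fin l → H} {v : Fin n → H}
    (hψ : P.weighted i = ∑ k, ketbra (ψ k)) (hv : Orthonormal ℂ v)
    (hE : E.elem i = ∑ j, ketbra (v j)) (j : Fin n) : ∑ k, ⟪ψ k, v j⟫_ℂ • ψ k = Z (v j) := by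
  rw [← h.weighted_apply hv hE, hψ, sum_apply]
  rfl

/-- Each Z w_ij is a combination of the ψ_ik, so ψ spans H, and it has dim H members. -/
theorem linearIndependent_of_weighted_eq (h : IsFrame P E Z w a) {ψ : (i : ι) × Fin (r i) → H}
    (hψ : ∀ i, P.weighted i = ∑ j, ketbra (ψ ⟨i, j⟩)) : LinearIndependent ℂ ψ := by
  refine linearIndependent_of_top_le_span_of_card_eq_finrank ?_ h.card_eq
  refine h.span_range_map.trans (Submodule.span_le.2 ?_)
  rintro _ ⟨⟨i, j⟩, rfl⟩
  have := h.sum_inner_smul (hψ i) (h.orthonormal.comp (Sigma.mk i) sigma_mk_injective)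
    (h.elem_eq i) j
  dsimp only [Function.comp] at this
  rw [SetLike.mem_coe]
  dsimp only
  rw [← this]
  exact sum_mem fun k _ => Submodule.smul_mem _ _ (Submodule.subset_span ⟨_, rfl⟩)

/-- Independence of choices: χ = Z v for the chosen eigenvectors v, and ∑_j |Z v_ij⟩⟨Z v_ij| = Z E_i
Z. -/
theorem prob_state_of_isRImage [DecidableEq ι] (h : IsFrame P E Z w a) {Q : Ensemble H ι}
    (hQ : IsRImage r P Q) :
    (∀ i, Q.prob i = (∑ j, ‖Z (w ⟨i, j⟩)‖ ^ 2) / ∑ l, ∑ k, ‖Z (w ⟨l, k⟩)‖ ^ 2) ∧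
    ∀ i, Q.state i = (((∑ j, ‖Z (w ⟨i, j⟩)‖ ^ 2)⁻¹ : ℝ) : ℂ) • ∑ j, ketbra (Z (w ⟨i, j⟩)) := by
  obtain ⟨E', ψ, v, χ, W, X, hopt, hψ, hv, hE', -, -, hX, -, hχ, hprob, hstate⟩ := hQ
  obtain rfl := (h.isOptimal_iff E').1 hopt
  have hψi := h.linearIndependent_of_weighted_eq hψ
  have hχZ : ∀ i j, χ ⟨i, j⟩ = Z (v ⟨i, j⟩) := by
    intro i j
    have := h.sum_inner_smul (hψ i) (hv.comp (Sigma.mk i) sigma_mk_injective) (hE' i) j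
    rw [hχ, ← Function.comp_apply (f := v) (g := Sigma.mk i), ← this]
    refine Finset.sum_congr rfl fun k _ => ?_
    rw [Matrix.blockDiag'_apply, Function.comp_apply, hX ⟨i, j⟩, inner_sum_smul_dualFamily hψi]
  have hket : ∀ i, ∑ j, ketbra (χ ⟨i, j⟩) = ∑ j, ketbra (Z (w ⟨i, j⟩)) := fun i => by
    simp only [hχZ]
    rw [h.sum_ketbra_map (hE' i), h.sum_ketbra_map (h.elem_eq i)]
  have hnorm : ∀ i, ∑ j, ‖χ ⟨i, j⟩‖ ^ 2 = ∑ j, ‖Z (w ⟨i, j⟩)‖ ^ 2 := fun i => by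
    rw [sum_norm_sq_eq, sum_norm_sq_eq, hket]
  simp only [hket, hnorm] at hprob hstate
  exact ⟨hprob, hstate⟩

/-- The frame supplies admissible choices: ψ_b = a_b^(-1/2) Z w_b and X_bc = ⟪ψ_b, w_c⟫, whose
diagonal blocks are diagonal with entries √a. -/
theorem isRImage_of_prob_state [DecidableEq ι] (h : IsFrame P E Z w a) {Q : Ensemble H ι}
    (hprob : ∀ i, Q.prob i = (∑ j, ‖Z (w ⟨i, j⟩)‖ ^ 2) / ∑ l, ∑ k, ‖Z (w ⟨l, k⟩)‖ ^ 2)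
    (hstate : ∀ i, Q.state i =
      (((∑ j, ‖Z (w ⟨i, j⟩)‖ ^ 2)⁻¹ : ℝ) : ℂ) • ∑ j, ketbra (Z (w ⟨i, j⟩))) :
    IsRImage r P Q := by
  set ψ : (i : ι) × Fin (r i) → H := fun b => (((√(a b))⁻¹ : ℝ) : ℂ) • Z (w b) with hψ_def
  have hψ : ∀ i, P.weighted i = ∑ j, ketbra (ψ ⟨i, j⟩) := fun i => by
    rw [h.weighted_eq]
    refine Finset.sum_congr rfl fun j _ => ?_
    rw [hψ_def]
    dsimp only
    rw [ketbra_smul, Complex.norm_real, Real.norm_eq_abs, sq_abs, inv_pow,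
      Real.sq_sqrt (h.pos _).le, Complex.ofReal_inv]
  have hψi := h.linearIndependent_of_weighted_eq hψ
  have hψs : ⊤ ≤ Submodule.span ℂ (Set.range ψ) :=
    (hψi.span_eq_top_of_card_eq_finrank' h.card_eq).ge
  set X : Matrix ((i : ι) × Fin (r i)) ((i : ι) × Fin (r i)) ℂ :=
    Matrix.of fun b c => ⟪ψ b, w c⟫_ℂ with hX_def
  -- Parseval in the orthonormal basis w.
  have hXX : X * X.conjTranspose = Matrix.gram ℂ ψ := by
    ext b c
    rw [Matrix.mul_apply, Matrix.gram_apply]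
    simpa [hX_def] using
      (OrthonormalBasis.mk h.orthonormal h.span_range.ge).sum_inner_mul_inner (ψ b) (ψ c)
  obtain ⟨W, hW, hXW⟩ := exists_unitary_sqrt_mul
    (Matrix.posDef_gram_of_linearIndependent hψi) hXX
  refine ⟨E, ψ, w, fun b => Z (w b), W, X, (h.isOptimal_iff E).2 rfl, hψ, h.orthonormal,
    h.elem_eq, hW, hXW, fun b => (sum_inner_smul_dualFamily hψi hψs (w b)).symm, fun i => ?_,
    fun i j => ?_, hprob, hstate⟩
  · have : X.blockDiag' i = Matrix.diagonal fun j => ((√(a ⟨i, j⟩) : ℝ) : ℂ) := by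
      ext j k
      rw [Matrix.blockDiag'_apply, Matrix.diagonal_apply, hX_def, Matrix.of_apply, hψ_def]
      dsimp only
      rw [inner_smul_left, ← inner_apply_comm h.cert.isPositive, h.inner_eq, Complex.conj_ofReal]
      split_ifs
      · rw [← Complex.ofReal_mul, inv_mul_eq_div, Real.div_sqrt]
      · rw [mul_zero]
    rw [this]
    exact Matrix.PosSemidef.diagonal fun j => Complex.zero_le_real.2 (Real.sqrt_nonneg _)
  · exact (h.sum_inner_smul (hψ i) (h.orthonormal.comp (Sigma.mk i) sigma_mk_injective)
      (h.elem_eq i) j).symm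

/-- The image of `P` under `ℛ` is the ensemble of the operators `Z * E i * Z`, normalized. -/
theorem exists_rImage [DecidableEq ι] (h : IsFrame P E Z w a) :
    ∃ Q : Ensemble H ι, (∀ Q', IsRImage r P Q' ↔ Q' = Q) ∧
      (∀ i, Q.prob i = (∑ j, ‖Z (w ⟨i, j⟩)‖ ^ 2) / ∑ l, ∑ k, ‖Z (w ⟨l, k⟩)‖ ^ 2) ∧
      (∀ i, Q.state i =
        (((∑ j, ‖Z (w ⟨i, j⟩)‖ ^ 2)⁻¹ : ℝ) : ℂ) • ∑ j, ketbra (Z (w ⟨i, j⟩))) ∧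
      (∀ i, Q.weighted i = (((∑ l, ∑ k, ‖Z (w ⟨l, k⟩)‖ ^ 2)⁻¹ : ℝ) : ℂ) •
        ∑ j, ketbra (Z (w ⟨i, j⟩))) ∧
      ∀ i, pgm Q i = E.elem i := by
  have hs := h.sum_norm_sq_pos
  have hc := h.sum_sum_norm_sq_pos
  let Q : Ensemble H ι :=
    { prob := fun i => (∑ j, ‖Z (w ⟨i, j⟩)‖ ^ 2) / ∑ l, ∑ k, ‖Z (w ⟨l, k⟩)‖ ^ 2
      state := fun i =>
        (((∑ j, ‖Z (w ⟨i, j⟩)‖ ^ 2)⁻¹ : ℝ) : ℂ) • ∑ j, ketbra (Z (w ⟨i, j⟩))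
      prob_pos := fun i => div_pos (hs i) hc
      prob_sum := by rw [← Finset.sum_div, div_self hc.ne']
      state_pos := fun i =>
        (ContinuousLinearMap.isPositive_sum _ fun j _ =>
          InnerProductSpace.isPositive_rankOne_self _).smul_of_nonneg
          (Complex.zero_le_real.2 (inv_nonneg.2 (hs i).le))
      state_trace := fun i => by
        rw [← opTrace_apply, map_smul, map_sum]
        simp only [opTrace_ketbra, smul_eq_mul]
        rw [← Complex.ofReal_sum, ← Complex.ofReal_mul, inv_mul_cancel₀ (hs i).ne',
          Complex.ofReal_one] }
  have hQ : ∀ i, Q.weighted i = (((∑ l, ∑ k, ‖Z (w ⟨l, k⟩)‖ ^ 2)⁻¹ : ℝ) : ℂ) •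
      ∑ j, ketbra (Z (w ⟨i, j⟩)) := fun i => by
    change ((_ / _ : ℝ) : ℂ) • (_ • _) = _
    rw [smul_smul, ← Complex.ofReal_mul, div_mul_eq_mul_div, mul_inv_cancel₀ (hs i).ne', one_div]
  refine ⟨Q, fun Q' => ⟨fun hQ' => ?_, ?_⟩, fun _ => rfl, fun _ => rfl, hQ, fun i => ?_⟩
  · obtain ⟨h1, h2⟩ := h.prob_state_of_isRImage hQ'
    exact Ensemble.ext (funext h1) (funext h2)
  · rintro rfl
    exact h.isRImage_of_prob_state (fun _ => rfl) fun _ => rfl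
  · exact pgm_eq h.cert.isPositive h.isUnit hc
      (fun i => by rw [hQ, h.sum_ketbra_map (h.elem_eq i)]) i

end IsFrame

end

section

variable {H : Type*} [NormedAddCommGroup H] [InnerProductSpace ℂ H] [CompleteSpace H]
  [FiniteDimensional ℂ H] {ι : Type*} [Fintype ι] {r : ι → ℕ} {P : Ensemble H ι} {E : POVM H ι}
  {Z : H →L[ℂ] H} {w : (i : ι) × Fin (r i) → H} {a : (i : ι) × Fin (r i) → ℝ}

/-! ### The pure ensemble of a frame -/

theorem ketbra_normalize (v : H) :
    ketbra (((‖v‖⁻¹ : ℝ) : ℂ) • v) = (((‖v‖ ^ 2)⁻¹ : ℝ) : ℂ) • ketbra v := by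
  rw [ketbra_smul, Complex.norm_real, Real.norm_eq_abs, sq_abs, inv_pow]

namespace IsFrame

/-- The decomposition of `P` into the pure states along the vectors `Z (w b)`. -/
noncomputable def pureEnsemble (h : IsFrame P E Z w a) : Ensemble H ((i : ι) × Fin (r i)) where
  prob b := (a b)⁻¹ * ‖Z (w b)‖ ^ 2
  state b := ketbra (((‖Z (w b)‖⁻¹ : ℝ) : ℂ) • Z (w b))
  prob_pos b := mul_pos (inv_pos.2 (h.pos b)) (pow_pos (norm_pos_iff.2 (h.map_ne_zero b)) 2)
  prob_sum := by
    rw [Fintype.sum_sigma, ← P.prob_sum]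
    refine Finset.sum_congr rfl fun i _ => ?_
    apply Complex.ofReal_injective
    rw [← P.opTrace_weighted, h.weighted_eq, map_sum, Complex.ofReal_sum]
    exact Finset.sum_congr rfl fun j _ => by
      rw [map_smul, opTrace_ketbra, smul_eq_mul, Complex.ofReal_mul, Complex.ofReal_inv]
  state_pos b := InnerProductSpace.isPositive_rankOne_self _
  state_trace b := by
    rw [← opTrace_apply, ketbra_normalize, map_smul, opTrace_ketbra, smul_eq_mul,
      ← Complex.ofReal_mul, inv_mul_cancel₀
        (pow_ne_zero 2 (norm_ne_zero_iff.2 (h.map_ne_zero b))), Complex.ofReal_one]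

/-- The measurement in the basis of a frame. -/
noncomputable def pureMeasurement (_h : IsFrame P E Z w a) : POVM H ((i : ι) × Fin (r i)) where
  elem b := ketbra (w b)
  elem_pos b := InnerProductSpace.isPositive_rankOne_self _
  elem_sum := by
    rw [Fintype.sum_sigma, ← E.elem_sum]
    exact Finset.sum_congr rfl fun i _ => (_h.elem_eq i).symm

theorem pureEnsemble_weighted (h : IsFrame P E Z w a) (b : (i : ι) × Fin (r i)) :
    h.pureEnsemble.weighted b = ((a b)⁻¹ : ℂ) • ketbra (Z (w b)) := by
  change (((a b)⁻¹ * ‖Z (w b)‖ ^ 2 : ℝ) : ℂ) • ketbra (((‖Z (w b)‖⁻¹ : ℝ) : ℂ) • Z (w b)) = _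
  rw [ketbra_normalize, smul_smul, ← Complex.ofReal_mul, mul_assoc,
    mul_inv_cancel₀ (pow_ne_zero 2 (norm_ne_zero_iff.2 (h.map_ne_zero b))), mul_one,
    Complex.ofReal_inv]

theorem pureEnsemble_isLI (h : IsFrame P E Z w a) : h.pureEnsemble.IsLI fun _ => 1 := by
  -- Each pure state has rank 1, so the second index runs over `Fin 1` and the first projection is a
  -- bijection.
  refine isLI_of_weighted_eq (v := fun c => Z (w c.1)) (d := fun c => ((a c.1)⁻¹ : ℂ))
    (fun c => inv_ne_zero (Complex.ofReal_ne_zero.2 (h.pos _).ne'))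
    (h.linearIndependent_map.comp Sigma.fst ?_) (h.span_range_map.trans (Submodule.span_mono ?_))
    fun b => by simpa using h.pureEnsemble_weighted b
  · rintro ⟨b, i⟩ ⟨c, j⟩ hbc
    obtain rfl : b = c := hbc
    rw [Subsingleton.elim i j]
  · rintro _ ⟨b, rfl⟩
    exact ⟨⟨b, 0⟩, rfl⟩

/-- Each pure term is one summand of R_i, hence below R_i ≤ Z; equality on w_b holds because a_b⁻¹
⟪Z w_b, w_b⟫ = 1. -/
theorem pureEnsemble_isDualCert (h : IsFrame P E Z w a) :
    IsDualCert h.pureEnsemble h.pureMeasurement Z := by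
  constructor
  · rintro ⟨i, j⟩
    have hle : h.pureEnsemble.weighted ⟨i, j⟩ ≤ P.weighted i := by
      rw [h.weighted_eq]
      simp only [← h.pureEnsemble_weighted]
      exact Finset.single_le_sum (f := fun j => h.pureEnsemble.weighted ⟨i, j⟩)
        (fun k _ => (ContinuousLinearMap.nonneg_iff_isPositive _).2
          (h.pureEnsemble.weighted_pos _)) (Finset.mem_univ j)
    have := (h.cert.sub_pos i).add hle
    rwa [sub_add_sub_cancel] at this
  · intro b
    change Z * ketbra (w b) = _ * ketbra (w b)
    rw [pureEnsemble_weighted, mul_ketbra, mul_ketbra, smul_apply,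
      InnerProductSpace.rankOne_apply, ← inner_apply_comm h.cert.isPositive, h.inner_eq b.1,
      if_pos rfl, smul_smul, inv_mul_cancel₀ (Complex.ofReal_ne_zero.2 (h.pos _).ne'), one_smul]

/-- The diagonal blocks now have size 1 and the same entries a_b, so the computation of ℛ applies to
the pure ensemble with the same Z. -/
theorem pure (h : IsFrame P E Z w a) :
    IsFrame (r := fun _ => 1) h.pureEnsemble h.pureMeasurement Z (fun c => w c.1)
      fun c => a c.1 where
  cert := h.pureEnsemble_isDualCert
  isUnit := h.isUnit
  isOptimal_iff := h.pureEnsemble_isDualCert.isOptimal_iff h.pureEnsemble_isLI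
  orthonormal := by
    refine h.orthonormal.comp Sigma.fst ?_
    rintro ⟨b, i⟩ ⟨c, j⟩ hbc
    obtain rfl : b = c := hbc
    rw [Subsingleton.elim i j]
  elem_eq b := by simp [pureMeasurement]
  pos c := h.pos c.1
  inner_eq b j k := by
    rw [if_pos (Subsingleton.elim j k), h.inner_eq b.1, if_pos rfl]
  weighted_eq b := by simpa using h.pureEnsemble_weighted b

end IsFrame

end

end MED

/-! ### Both claims from a single frame -/

theorem mainTheorem8 {H : Type*} [NormedAddCommGroup H] [InnerProductSpace ℂ H] [CompleteSpace H]
    [FiniteDimensional ℂ H] {m : ℕ} (r : Fin m → ℕ) (P : Ensemble H (Fin m)) (hP : P.IsLI r) :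
    ∃ (E : POVM H (Fin m)) (Q : Ensemble H (Fin m))
      (A B : Ensemble H ((i : Fin m) × Fin (r i))) (F : POVM H ((i : Fin m) × Fin (r i)))
      (ψ w : (i : Fin m) × Fin (r i) → H),
      -- `E` is the optimal POVM of `P`, and `Q = ℛ(P)`, whose pretty good measurement is `E`
      (∀ E', IsOptimal P E' ↔ E' = E) ∧
      (∀ Q', IsRImage r P Q' ↔ Q' = Q) ∧
      Q.IsLI r ∧
      (∀ i, pgm Q i = E.elem i) ∧
      -- `A` is a decomposition of `P` into linearly independent pure states
      IsPureDecomposition P A ψ ∧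
      LinearIndependent ℂ ψ ∧
      A.IsLI (fun _ => 1) ∧
      -- the optimal POVM `F` of `A` is a rank-one refinement of `E`
      (∀ F', IsOptimal A F' ↔ F' = F) ∧
      Orthonormal ℂ w ∧
      (∀ a, F.elem a = ketbra (w a)) ∧
      (∀ i, E.elem i = ∑ j, ketbra (w ⟨i, j⟩)) ∧
      -- `B = ℛ(A)` is a decomposition of `Q` into the same pure states, and its pretty good
      -- measurement is `F`
      (∀ B', IsRImage (fun _ => 1) A B' ↔ B' = B) ∧
      IsPureDecomposition Q B ψ ∧
      (∀ a, pgm B a = F.elem a) := by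
  obtain ⟨E, Z, w, a, h⟩ := hP.exists_isFrame
  obtain ⟨Q, hQ, -, -, hQw, hQE⟩ := h.exists_rImage
  obtain ⟨B, hB, -, hBs, hBw, hBF⟩ := h.pure.exists_rImage
  have hnorm : ∀ b, ‖((‖Z (w b)‖⁻¹ : ℝ) : ℂ) • Z (w b)‖ = 1 := fun b => by
    rw [norm_smul, Complex.norm_real, norm_inv, norm_norm,
      inv_mul_cancel₀ (norm_ne_zero_iff.2 (h.map_ne_zero b))]
  have hinv : ∀ b, ((‖Z (w b)‖⁻¹ : ℝ) : ℂ) ≠ 0 := fun b =>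
    Complex.ofReal_ne_zero.2 (inv_ne_zero (norm_ne_zero_iff.2 (h.map_ne_zero b)))
  refine ⟨E, Q, h.pureEnsemble, B, h.pureMeasurement,
    fun b => ((‖Z (w b)‖⁻¹ : ℝ) : ℂ) • Z (w b), w, h.isOptimal_iff, hQ, ?_, hQE,
    ⟨hnorm, fun _ => rfl, fun i => ?_⟩, ?_, h.pureEnsemble_isLI, h.pure.isOptimal_iff,
    h.orthonormal, fun _ => rfl, h.elem_eq, hB, ⟨hnorm, fun b => ?_, fun i => ?_⟩, hBF⟩
  · refine h.isLI (d := fun _ => (((∑ l, ∑ k, ‖Z (w ⟨l, k⟩)‖ ^ 2)⁻¹ : ℝ) : ℂ))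
      (fun _ => Complex.ofReal_ne_zero.2 (inv_ne_zero h.sum_sum_norm_sq_pos.ne')) fun i => ?_
    rw [hQw, Finset.smul_sum]
  · rw [h.weighted_eq]
    exact Finset.sum_congr rfl fun j _ => (h.pureEnsemble_weighted _).symm
  · exact h.linearIndependent_map.units_smul fun b => Units.mk0 _ (hinv b)
  · rw [hBs, ketbra_normalize]
    simp
  -- ℛ(P) and ℛ(A) have the same normalization, the sum of all ‖Z w_b‖².
  · rw [hQw, Finset.smul_sum]
    refine Finset.sum_congr rfl fun j _ => ?_
    rw [hBw]
    simp [Fintype.sum_sigma]
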